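/- Throughout, a graph is finite, connected and loopless, possibly with parallel edges; its genus is $g=|E(G)|-|V(G)|+1$. A divisor on $G$ is a formal integer combination $D$ of vertices, $\deg D$ is the sum of its coefficients, linear equivalence is chip-firing equivalence, and $r(D)$ is the Baker–Norine rank: the largest integer $r\ge -1$ such that $D-E$ is linearly equivalent to an effective divisor for every effective divisor $E$ of degree $r$ (a vacuous condition for $r=-1$). A graph $G$ of genus $g$ is called Brill–Noether general if, for all integers $d$ and $r\ge -1$ such that there is a divisor $D$ on $G$ with $\deg D=d$ and $r(D)\ge r$, one has $\rho(g,r,d)=g-(r+1)(g-d+r)\ge 0$. For a once-marked graph $(G,v)$ of genus $g$ (a graph with a chosen vertex $v$) and a divisor $D$ on $G$, put, for $i\ge 0$, $$s_i(D,v)=\min\{\ell\in\mathbb{Z}: r(D+\ell v)\ge i\},\qquad \lambda_i(D,v)=i-s_i(D,v)+g-\deg D .$$ By Riemann–Roch these $\lambda_i(D,v)$ are nonnegative and almost all zero; let $|\lambda(D,v)|=\sum_{i\ge 0}\lambda_i(D,v)$. The marked graph $(G,v)$ is called Brill–Noether general if $|\lambda(D,v)|\le g$ for all divisors $D$ on $G$.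 **Proposition.** Let $(G_1,v_1)$ and $(G_2,v_2)$ be two Brill–Noether general once-marked graphs of genera $g_1$ and $g_2$, and let $G$ be the graph obtained from the disjoint union of $G_1$ and $G_2$ by identifying $v_1$ with $v_2$. Then $G$ is a graph of genus $g_1+g_2$, and it is Brill–Noether general. -/

import Mathlib

open scoped Graph

noncomputable section

namespace BrillNoether

variable {α β : Type*}

/-- A graph in the sense used here is a finite, connected, loopless multigraph. (Connectedness
only depends on the adjacency relation, so it is read off the underlying simple graph; it
includes that there is at least one vertex.) -/
structure IsFiniteConnectedLoopless (G : Graph α β) : Prop where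
  finite_vertexSet : V(G).Finite
  finite_edgeSet : E(G).Finite
  loopless : G.Loopless
  connected : G.toSimpleGraph.Connected

/-- The genus `|E(G)| - |V(G)| + 1`. -/
def genus (G : Graph α β) : ℤ :=
  (E(G).ncard : ℤ) - (V(G).ncard : ℤ) + 1

/-- A divisor on `G` is an integer-valued function on the vertices. It is effective when
`0 ≤ D` for the pointwise order. -/
abbrev Divisor (G : Graph α β) : Type _ := V(G) → ℤ

variable {G : Graph α β}

/-- The degree of a divisor. -/
def degree (D : Divisor G) : ℤ := ∑ᶠ x : V(G), D x

open Classical in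
/-- The divisor consisting of the vertex `v` with multiplicity one. -/
def ofVertex (v : V(G)) : Divisor G := Pi.single v 1

/-- The principal divisor of an integer-valued function `f` on the vertices: its value at `x` is
the sum of `f y - f x` over all edges from `x` to another vertex `y`, with multiplicity. -/
def principal (f : V(G) → ℤ) : Divisor G := fun x =>
  ∑ᶠ y : V(G), ({e : β | G.IsLink e x y}.ncard : ℤ) * (f y - f x)

/-- Linear equivalence of divisors (chip-firing equivalence). -/
def LinEquiv (D D' : Divisor G) : Prop :=
  ∃ f : V(G) → ℤ, D' = D + principal f

/-- The Baker-Norine rank: the largest integer `r ≥ -1` such that for every effective divisor `E`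
of degree `r` the divisor `D - E` is linearly equivalent to an effective divisor. For `r = -1` the
condition is vacuous, so the rank is `-1` when `D` is not equivalent to an effective divisor. -/
def rank (D : Divisor G) : ℤ :=
  sSup {r : ℤ | -1 ≤ r ∧ ∀ E : Divisor G, 0 ≤ E → degree E = r →
    ∃ F : Divisor G, 0 ≤ F ∧ LinEquiv (D - E) F}

/-- The divisor census of a graph: the pairs `(d, r)`, with `r ≥ -1`, for which some divisor has
degree `d` and rank at least `r`. -/
def divisorCensus (G : Graph α β) : Set (ℤ × ℤ) :=
  {p | -1 ≤ p.2 ∧ ∃ D : Divisor G, degree D = p.1 ∧ p.2 ≤ rank D}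

/-- The Brill-Noether number `ρ(g, r, d) = g - (r + 1) (g - d + r)`. -/
def brillNoetherNumber (g r d : ℤ) : ℤ := g - (r + 1) * (g - d + r)

/-- `G` is Brill-Noether general: every `(d, r)` in its divisor census has `ρ(g, r, d) ≥ 0`. -/
def IsBrillNoetherGeneral (G : Graph α β) : Prop :=
  ∀ d r : ℤ, (d, r) ∈ divisorCensus G → 0 ≤ brillNoetherNumber (genus G) r d

/-- `s_i(D, v)` is the smallest integer `ℓ` such that `D + ℓ v` has rank at least `i`. -/
def poleOrder (D : Divisor G) (v : V(G)) (i : ℕ) : ℤ :=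
  sInf {ℓ : ℤ | (i : ℤ) ≤ rank (D + ℓ • ofVertex v)}

/-- The parts `λ_i(D, v) = i - s_i(D, v) + g - deg D` of the Weierstrass partition. -/
def weierstrassPart (D : Divisor G) (v : V(G)) (i : ℕ) : ℤ :=
  (i : ℤ) - poleOrder D v i + genus G - degree D

/-- The size `|λ(D, v)|`, the sum of all parts of the Weierstrass partition, as an extended natural
number. The parts are nonnegative and almost all zero on a finite connected graph, by
Riemann-Roch, so `Int.toNat` truncates nothing and the sum is finite. -/
def weierstrassSize (D : Divisor G) (v : V(G)) : ℕ∞ :=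
  ∑' i : ℕ, ((weierstrassPart D v i).toNat : ℕ∞)

/-- The once-marked graph `(G, v)` is Brill-Noether general: `|λ(D, v)| ≤ g` for every
divisor `D` on `G`. -/
def IsMarkedBrillNoetherGeneral (G : Graph α β) (v : V(G)) : Prop :=
  ∀ D : Divisor G, ∃ n : ℕ, weierstrassSize D v = n ∧ (n : ℤ) ≤ genus G

open Classical in
/-- The map sending the vertices of the second graph to those of a vertex gluing: `v₂` becomes
`v₁`, and all other vertices are kept. -/
def glueRight {α₁ α₂ : Type*} (v₁ : α₁) (v₂ : α₂) (x : α₂) : α₁ ⊕ α₂ :=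
  if x = v₂ then Sum.inl v₁ else Sum.inr x

theorem glueRight_injective {α₁ α₂ : Type*} (v₁ : α₁) (v₂ : α₂) :
    Function.Injective (glueRight v₁ v₂) := by
  intro x y h
  unfold glueRight at h
  split_ifs at h <;> simp_all

/-- The vertex gluing of `(G₁, v₁)` and `(G₂, v₂)`: the disjoint union of the two graphs with `v₁`
and `v₂` identified. The common vertex is represented by `Sum.inl v₁`. -/
def vertexGluing {α₁ β₁ α₂ β₂ : Type*} (G₁ : Graph α₁ β₁) (v₁ : V(G₁))
    (G₂ : Graph α₂ β₂) (v₂ : V(G₂)) : Graph (α₁ ⊕ α₂) (β₁ ⊕ β₂) where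
  vertexSet := Sum.inl '' V(G₁) ∪ glueRight v₁.1 v₂.1 '' V(G₂)
  IsLink e x y :=
    (∃ e₁ a b, G₁.IsLink e₁ a b ∧ e = Sum.inl e₁ ∧ x = Sum.inl a ∧ y = Sum.inl b) ∨
    (∃ e₂ a b, G₂.IsLink e₂ a b ∧ e = Sum.inr e₂ ∧
      x = glueRight v₁.1 v₂.1 a ∧ y = glueRight v₁.1 v₂.1 b)
  isLink_symm := by
    intro e _
    constructor
    rintro x y (⟨e₁, a, b, h, rfl, rfl, rfl⟩ | ⟨e₂, a, b, h, rfl, rfl, rfl⟩)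
    · exact Or.inl ⟨e₁, b, a, h.symm, rfl, rfl, rfl⟩
    · exact Or.inr ⟨e₂, b, a, h.symm, rfl, rfl, rfl⟩
  eq_or_eq_of_isLink_of_isLink := by
    rintro e x y v w (⟨e₁, a, b, h, rfl, rfl, rfl⟩ | ⟨e₂, a, b, h, rfl, rfl, rfl⟩)
      (⟨e₁', a', b', h', he, rfl, rfl⟩ | ⟨e₂', a', b', h', he, rfl, rfl⟩)
    · obtain rfl := Sum.inl_injective he
      rcases G₁.eq_or_eq_of_isLink_of_isLink h h' with rfl | rfl <;> simp
    · cases he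
    · cases he
    · obtain rfl := Sum.inr_injective he
      rcases G₂.eq_or_eq_of_isLink_of_isLink h h' with rfl | rfl <;> simp
  left_mem_of_isLink := by
    rintro e x y (⟨e₁, a, b, h, rfl, rfl, rfl⟩ | ⟨e₂, a, b, h, rfl, rfl, rfl⟩)
    · exact Or.inl ⟨a, h.left_mem, rfl⟩
    · exact Or.inr ⟨a, h.left_mem, rfl⟩

end BrillNoether

end

open scoped Graph

noncomputable section

namespace BrillNoether

/-! The two sides of a vertex gluing meet only at the common vertex, so a firing script on the
gluing is a pair of scripts that exchange chips only there. Write a divisor on the gluing as a sum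
of `D₁` and `D₂` supported on the two sides. If it has rank at least `r` and `i + j = r`, then
`s_i(D₁, v₁) + s_j(D₂, v₂) ≤ 0` (`poleOrder_add_poleOrder_le`): choose effective divisors of degrees
`i` and `j` that detect the two pole orders, subtract both, and split the resulting effective
divisor (`exists_isEquivEffective_of_glueDivisor`).

In terms of parts, `λ_i(D₁) + λ_{r-i}(D₂) ≥ g₁ + g₂ - d + r`. Summing over `0 ≤ i ≤ r` bounds `(r +
1)(g - d + r)` by two partial sums of Weierstrass parts, hence by `g₁ + g₂ = g`
(`le_genus_add_genus`). Riemann–Roch is not needed. -/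

theorem finsum_extend_zero {ι κ M : Type*} [AddCommMonoid M] {φ : ι → κ}
    (hφ : Function.Injective φ) (h : ι → M) :
    ∑ᶠ z, Function.extend φ h 0 z = ∑ᶠ x, h x := by
  have hs : Function.support (Function.extend φ h 0) ⊆ Set.range φ := fun z hz => by
    by_contra hn
    exact hz (Function.extend_apply' _ _ _ hn)
  rw [← finsum_mem_univ, finsum_mem_inter_support_eq' _ Set.univ (Set.range φ)
    (fun z hz => iff_of_true (Set.mem_univ z) (hs hz)), finsum_mem_range hφ]
  simp only [hφ.extend_apply]

theorem summable_enat {ι : Type*} (f : ι → ℕ∞) : Summable f :=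
  ⟨_, tendsto_atTop_iSup fun _ _ => Finset.sum_le_sum_of_subset⟩

/-! ### Degree, linear equivalence and rank on a single graph -/

section Divisors

variable {α β : Type*} {G : Graph α β}

theorem degree_add [Finite V(G)] (D E : Divisor G) : degree (D + E) = degree D + degree E :=
  finsum_add_distrib (Set.toFinite _) (Set.toFinite _)

theorem degree_sub [Finite V(G)] (D E : Divisor G) : degree (D - E) = degree D - degree E :=
  finsum_sub_distrib (Set.toFinite _) (Set.toFinite _)

theorem degree_nonneg {D : Divisor G} (h : 0 ≤ D) : 0 ≤ degree D :=
  finsum_nonneg h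

theorem degree_zsmul_ofVertex (n : ℤ) (v : V(G)) : degree (n • ofVertex v) = n := by
  classical
  unfold degree
  rw [finsum_eq_single _ v]
  · simp [ofVertex]
  · intro x hx
    simp [ofVertex, Pi.single_eq_of_ne hx]

theorem ofVertex_nonneg (v : V(G)) : 0 ≤ ofVertex v := by
  classical
  exact Pi.single_nonneg.2 zero_le_one

theorem degree_principal [Finite V(G)] (f : V(G) → ℤ) : degree (principal f) = 0 := by
  have := Fintype.ofFinite V(G)
  have hsymm : ∀ x y : V(G), {e : β | G.IsLink e x y} = {e : β | G.IsLink e y x} := fun x y =>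
    Set.ext fun e => Graph.isLink_comm
  -- The contribution of an edge is antisymmetric in its two ends, so exchanging the summations
  -- changes the sign.
  have hneg : degree (principal f) = -degree (principal f) := by
    simp only [degree, principal, finsum_eq_sum_of_fintype]
    conv_lhs => rw [Finset.sum_comm]
    simp only [← Finset.sum_neg_distrib]
    refine Finset.sum_congr rfl fun x _ => Finset.sum_congr rfl fun y _ => ?_
    rw [hsymm y x]
    ring
  lia

/-- `D` is linearly equivalent to an effective divisor. -/
def IsEquivEffective (D : Divisor G) : Prop :=
  ∃ f : V(G) → ℤ, 0 ≤ D + principal f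

theorem exists_linEquiv_iff {D : Divisor G} :
    (∃ F : Divisor G, 0 ≤ F ∧ LinEquiv D F) ↔ IsEquivEffective D := by
  constructor
  · rintro ⟨F, hF, f, rfl⟩
    exact ⟨f, hF⟩
  · rintro ⟨f, hf⟩
    exact ⟨_, hf, f, rfl⟩

theorem IsEquivEffective.mono {D D' : Divisor G} (h : IsEquivEffective D) (hD : D ≤ D') :
    IsEquivEffective D' := by
  obtain ⟨f, hf⟩ := h
  exact ⟨f, hf.trans (add_le_add_left hD _)⟩

theorem IsEquivEffective.degree_nonneg [Finite V(G)] {D : Divisor G} (h : IsEquivEffective D) :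
    0 ≤ degree D := by
  obtain ⟨f, hf⟩ := h
  have := BrillNoether.degree_nonneg hf
  rwa [degree_add, degree_principal, add_zero] at this

/-- The numbers over which the supremum defining `rank D` is taken. -/
def rankSet (D : Divisor G) : Set ℤ :=
  {r : ℤ | -1 ≤ r ∧ ∀ E : Divisor G, 0 ≤ E → degree E = r → IsEquivEffective (D - E)}

theorem rank_eq_sSup_rankSet (D : Divisor G) : rank D = sSup (rankSet D) := by
  simp only [rank, rankSet, exists_linEquiv_iff]

theorem le_degree_of_mem_rankSet [Finite V(G)] (v : V(G)) {D : Divisor G} {r : ℤ} (hr : 0 ≤ r)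
    (h : r ∈ rankSet D) : r ≤ degree D := by
  have := (h.2 (r • ofVertex v) (smul_nonneg hr (ofVertex_nonneg v))
    (degree_zsmul_ofVertex r v)).degree_nonneg
  rw [degree_sub, degree_zsmul_ofVertex] at this
  lia

theorem bddAbove_rankSet [Finite V(G)] (v : V(G)) (D : Divisor G) : BddAbove (rankSet D) := by
  refine ⟨max 0 (degree D), fun r h => ?_⟩
  rcases le_total r 0 with hr | hr
  · exact le_max_of_le_left hr
  · exact le_max_of_le_right (le_degree_of_mem_rankSet v hr h)

theorem neg_one_mem_rankSet (D : Divisor G) : -1 ∈ rankSet D := by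
  refine ⟨le_rfl, fun E hE hd => ?_⟩
  have := degree_nonneg hE
  lia

/-- Pad `E` with `s - r` chips at `v`: removing fewer chips is easier. -/
theorem mem_rankSet_of_le [Finite V(G)] (v : V(G)) {D : Divisor G} {r s : ℤ} (hr : -1 ≤ r)
    (hrs : r ≤ s) (h : s ∈ rankSet D) : r ∈ rankSet D := by
  refine ⟨hr, fun E hE hd => ?_⟩
  refine (h.2 (E + (s - r) • ofVertex v)
    (add_nonneg hE (smul_nonneg (by lia) (ofVertex_nonneg v))) ?_).mono ?_
  · rw [degree_add, degree_zsmul_ofVertex, hd]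
    ring
  · exact sub_le_sub_left (le_add_of_nonneg_right
      (smul_nonneg (by lia) (ofVertex_nonneg v))) _

theorem le_rank_iff [Finite V(G)] (v : V(G)) {D : Divisor G} {r : ℤ} (hr : 0 ≤ r) :
    r ≤ rank D ↔
      ∀ E : Divisor G, 0 ≤ E → degree E = r → IsEquivEffective (D - E) := by
  rw [rank_eq_sSup_rankSet]
  constructor
  · intro h
    exact (mem_rankSet_of_le v (by lia) h
      (Int.csSup_mem ⟨-1, neg_one_mem_rankSet D⟩ (bddAbove_rankSet v D))).2
  · intro h
    exact le_csSup (bddAbove_rankSet v D) ⟨by lia, h⟩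

theorem le_degree_of_le_rank [Finite V(G)] (v : V(G)) {D : Divisor G} {r : ℤ} (hr : 0 ≤ r)
    (h : r ≤ rank D) : r ≤ degree D :=
  le_degree_of_mem_rankSet v hr ⟨by lia, (le_rank_iff v hr).1 h⟩

/-! ### Pole orders and Weierstrass parts -/

theorem poleOrder_le [Finite V(G)] {D : Divisor G} {v : V(G)} {i : ℕ} {l : ℤ}
    (h : (i : ℤ) ≤ rank (D + l • ofVertex v)) : poleOrder D v i ≤ l := by
  refine csInf_le ⟨-degree D, fun m hm => ?_⟩ h
  have := le_degree_of_le_rank v (Int.natCast_nonneg i) hm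
  rw [degree_add, degree_zsmul_ofVertex] at this
  lia

/-- Some effective divisor of degree `i` can only be subtracted from `D + l v` when `l` is at
least the `i`-th pole order. -/
theorem exists_forall_poleOrder_le [Finite V(G)] (D : Divisor G) (v : V(G)) (i : ℕ) :
    ∃ E : Divisor G, 0 ≤ E ∧ degree E = i ∧
      ∀ l : ℤ, IsEquivEffective (D + l • ofVertex v - E) → poleOrder D v i ≤ l := by
  -- Only the lower bound on the set of admissible `ℓ` is used; this would hold even if the set were
  -- empty and the infimum took its default value.
  have h : ¬ (i : ℤ) ≤ rank (D + (poleOrder D v i - 1) • ofVertex v) := fun h => by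
    have := poleOrder_le h
    lia
  rw [le_rank_iff v (Int.natCast_nonneg i)] at h
  push Not at h
  obtain ⟨E, hE, hd, hn⟩ := h
  refine ⟨E, hE, hd, fun l hl => ?_⟩
  by_contra! hlt
  refine hn (hl.mono (sub_le_sub_right (add_le_add_right ?_ _) _))
  exact smul_le_smul_of_nonneg_right (by lia) (ofVertex_nonneg v)

theorem nonneg_add_zsmul_ofVertex {D : Divisor G} {v : V(G)}
    (h : ∀ x ≠ v, 0 ≤ D x) : 0 ≤ D + (-D v) • ofVertex v := by
  classical
  intro x
  by_cases hx : x = v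
  · simp [hx, ofVertex]
  · simpa [ofVertex, hx] using h x hx

/-- Truncation by `Int.toNat` only increases a part, so partial sums stay below the total without
knowing that parts are nonnegative or almost all zero. -/
theorem sum_weierstrassPart_le {v : V(G)} (h : IsMarkedBrillNoetherGeneral G v) (D : Divisor G)
    (s : Finset ℕ) : ∑ i ∈ s, weierstrassPart D v i ≤ genus G := by
  obtain ⟨n, hn, hle⟩ := h D
  have h1 : ∑ i ∈ s, ((weierstrassPart D v i).toNat : ℕ∞) ≤ n :=
    hn ▸ Summable.sum_le_tsum s (fun _ _ => zero_le) (summable_enat _)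
  have h2 : ∑ i ∈ s, (weierstrassPart D v i).toNat ≤ n := by exact_mod_cast h1
  calc ∑ i ∈ s, weierstrassPart D v i
      ≤ ∑ i ∈ s, ((weierstrassPart D v i).toNat : ℤ) :=
        Finset.sum_le_sum fun i _ => Int.self_le_toNat _
    _ ≤ n := by exact_mod_cast h2
    _ ≤ genus G := hle

end Divisors

/-! ### Vertices, edges and connectedness of the vertex gluing -/

section Gluing

variable {α₁ β₁ α₂ β₂ : Type*} {G₁ : Graph α₁ β₁} {G₂ : Graph α₂ β₂} (v₁ : V(G₁)) (v₂ : V(G₂))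

/-- The inclusion of the vertices of the first graph in a vertex gluing. -/
def gluingInl (x : V(G₁)) : V(vertexGluing G₁ v₁ G₂ v₂) :=
  ⟨Sum.inl x.1, Or.inl ⟨x.1, x.2, rfl⟩⟩

/-- The inclusion of the vertices of the second graph in a vertex gluing. -/
def gluingInr (x : V(G₂)) : V(vertexGluing G₁ v₁ G₂ v₂) :=
  ⟨glueRight v₁.1 v₂.1 x.1, Or.inr ⟨x.1, x.2, rfl⟩⟩

theorem gluingInl_injective : Function.Injective (gluingInl v₁ v₂) := fun _ _ h =>
  Subtype.ext (Sum.inl_injective (congrArg Subtype.val h))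

theorem gluingInr_injective : Function.Injective (gluingInr v₁ v₂) := fun _ _ h =>
  Subtype.ext (glueRight_injective _ _ (congrArg Subtype.val h))

theorem glueRight_eq_inl_iff {x : α₂} {a a' : α₁} {b : α₂} :
    glueRight a b x = Sum.inl a' ↔ x = b ∧ a' = a := by
  unfold glueRight
  split_ifs with h <;> simp [h, eq_comm]

theorem gluingInl_eq_gluingInr_iff {x : V(G₁)} {y : V(G₂)} :
    gluingInl v₁ v₂ x = gluingInr v₁ v₂ y ↔ x = v₁ ∧ y = v₂ := by
  rw [eq_comm, Subtype.ext_iff, Subtype.ext_iff, Subtype.ext_iff]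
  simp only [gluingInl, gluingInr, glueRight_eq_inl_iff, and_comm]

theorem gluingInl_self : gluingInl v₁ v₂ v₁ = gluingInr v₁ v₂ v₂ :=
  (gluingInl_eq_gluingInr_iff v₁ v₂).2 ⟨rfl, rfl⟩

theorem gluing_cases (z : V(vertexGluing G₁ v₁ G₂ v₂)) :
    (∃ x, gluingInl v₁ v₂ x = z) ∨ ∃ y, gluingInr v₁ v₂ y = z := by
  obtain ⟨_, ⟨x, hx, rfl⟩ | ⟨y, hy, rfl⟩⟩ := z
  · exact Or.inl ⟨⟨x, hx⟩, rfl⟩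
  · exact Or.inr ⟨⟨y, hy⟩, rfl⟩

theorem range_gluingInl_union_range_gluingInr :
    Set.range (gluingInl v₁ v₂) ∪ Set.range (gluingInr v₁ v₂) = Set.univ :=
  Set.eq_univ_of_forall (gluing_cases v₁ v₂)

theorem range_gluingInl_inter_range_gluingInr :
    Set.range (gluingInl v₁ v₂) ∩ Set.range (gluingInr v₁ v₂) = {gluingInl v₁ v₂ v₁} := by
  ext z
  constructor
  · rintro ⟨⟨x, rfl⟩, ⟨y, hy⟩⟩
    rw [((gluingInl_eq_gluingInr_iff v₁ v₂).1 hy.symm).1]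
    rfl
  · rintro rfl
    exact ⟨⟨v₁, rfl⟩, ⟨v₂, (gluingInl_self v₁ v₂).symm⟩⟩

theorem finite_gluing [Finite V(G₁)] [Finite V(G₂)] : Finite V(vertexGluing G₁ v₁ G₂ v₂) := by
  rw [← Set.finite_univ_iff, ← range_gluingInl_union_range_gluingInr]
  exact (Set.finite_range _).union (Set.finite_range _)

/-- Inclusion–exclusion: the two sides overlap exactly in the common vertex. -/
theorem finsum_gluing [Finite V(G₁)] [Finite V(G₂)] (h : V(vertexGluing G₁ v₁ G₂ v₂) → ℤ) :
    ∑ᶠ z, h z = ∑ᶠ x, h (gluingInl v₁ v₂ x) + ∑ᶠ y, h (gluingInr v₁ v₂ y) -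
      h (gluingInl v₁ v₂ v₁) := by
  have key := finsum_mem_union_inter (f := h) (Set.finite_range (gluingInl v₁ v₂))
    (Set.finite_range (gluingInr v₁ v₂))
  rw [range_gluingInl_union_range_gluingInr, range_gluingInl_inter_range_gluingInr,
    finsum_mem_univ, finsum_mem_singleton, finsum_mem_range (gluingInl_injective v₁ v₂),
    finsum_mem_range (gluingInr_injective v₁ v₂)] at key
  lia

theorem isLink_gluing_inl_inl [G₂.Loopless] {e : β₁ ⊕ β₂} {x y : V(G₁)} :
    (vertexGluing G₁ v₁ G₂ v₂).IsLink e (gluingInl v₁ v₂ x) (gluingInl v₁ v₂ y) ↔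
      ∃ e₁, e = Sum.inl e₁ ∧ G₁.IsLink e₁ x y := by
  constructor
  · rintro (⟨e₁, a, b, h, rfl, hx, hy⟩ | ⟨e₂, a, b, h, rfl, hx, hy⟩)
    · obtain rfl := Sum.inl_injective hx
      obtain rfl := Sum.inl_injective hy
      exact ⟨e₁, rfl, h⟩
    -- An edge of `G₂` with both ends on the first side would be a loop at `v₂`.
    · exact absurd ((glueRight_eq_inl_iff.1 hx.symm).1.trans
        (glueRight_eq_inl_iff.1 hy.symm).1.symm) h.ne
  · rintro ⟨e₁, rfl, h⟩
    exact Or.inl ⟨e₁, x, y, h, rfl, rfl, rfl⟩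

theorem isLink_gluing_inr_inr [G₁.Loopless] {e : β₁ ⊕ β₂} {x y : V(G₂)} :
    (vertexGluing G₁ v₁ G₂ v₂).IsLink e (gluingInr v₁ v₂ x) (gluingInr v₁ v₂ y) ↔
      ∃ e₂, e = Sum.inr e₂ ∧ G₂.IsLink e₂ x y := by
  constructor
  · rintro (⟨e₁, a, b, h, rfl, hx, hy⟩ | ⟨e₂, a, b, h, rfl, hx, hy⟩)
    · exact absurd ((glueRight_eq_inl_iff.1 hx).2.trans
        (glueRight_eq_inl_iff.1 hy).2.symm) h.ne
    · obtain rfl := glueRight_injective _ _ hx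
      obtain rfl := glueRight_injective _ _ hy
      exact ⟨e₂, rfl, h⟩
  · rintro ⟨e₂, rfl, h⟩
    exact Or.inr ⟨e₂, x, y, h, rfl, rfl, rfl⟩

theorem eq_or_eq_of_isLink_gluing_inl_inr {e : β₁ ⊕ β₂} {x : V(G₁)} {y : V(G₂)}
    (h : (vertexGluing G₁ v₁ G₂ v₂).IsLink e (gluingInl v₁ v₂ x) (gluingInr v₁ v₂ y)) :
    x = v₁ ∨ y = v₂ := by
  rcases h with ⟨e₁, a, b, -, -, -, hy⟩ | ⟨e₂, a, b, -, -, hx, -⟩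
  · exact Or.inr (Subtype.ext (glueRight_eq_inl_iff.1 hy).1)
  · exact Or.inl (Subtype.ext (glueRight_eq_inl_iff.1 hx.symm).2)

theorem ncard_isLink_gluing_inl_inl [G₂.Loopless] (x y : V(G₁)) :
    {e | (vertexGluing G₁ v₁ G₂ v₂).IsLink e (gluingInl v₁ v₂ x) (gluingInl v₁ v₂ y)}.ncard =
      {e | G₁.IsLink e x y}.ncard := by
  rw [← Set.ncard_image_of_injective _ (Sum.inl_injective (α := β₁) (β := β₂))]
  congr 1
  ext e
  simp only [Set.mem_ofPred_eq, isLink_gluing_inl_inl, Set.mem_image]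
  grind

theorem ncard_isLink_gluing_inr_inr [G₁.Loopless] (x y : V(G₂)) :
    {e | (vertexGluing G₁ v₁ G₂ v₂).IsLink e (gluingInr v₁ v₂ x) (gluingInr v₁ v₂ y)}.ncard =
      {e | G₂.IsLink e x y}.ncard := by
  rw [← Set.ncard_image_of_injective _ (Sum.inr_injective (α := β₁) (β := β₂))]
  congr 1
  ext e
  simp only [Set.mem_ofPred_eq, isLink_gluing_inr_inr, Set.mem_image]
  grind

theorem ncard_isLink_gluing_inl_inr {x : V(G₁)} {y : V(G₂)} (hx : x ≠ v₁) (hy : y ≠ v₂) :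
    {e | (vertexGluing G₁ v₁ G₂ v₂).IsLink e (gluingInl v₁ v₂ x) (gluingInr v₁ v₂ y)}.ncard =
      0 := by
  refine (congrArg Set.ncard (Set.eq_empty_of_forall_notMem fun e h => ?_)).trans
    (Set.ncard_empty _)
  exact (eq_or_eq_of_isLink_gluing_inl_inr v₁ v₂ h).elim hx hy

theorem edgeSet_gluing :
    E(vertexGluing G₁ v₁ G₂ v₂) = Sum.inl '' E(G₁) ∪ Sum.inr '' E(G₂) := by
  ext e
  constructor
  · rintro ⟨x, y, ⟨e₁, a, b, h, rfl, -, -⟩ | ⟨e₂, a, b, h, rfl, -, -⟩⟩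
    · exact Or.inl ⟨e₁, h.edge_mem, rfl⟩
    · exact Or.inr ⟨e₂, h.edge_mem, rfl⟩
  · rintro (⟨e₁, he, rfl⟩ | ⟨e₂, he, rfl⟩)
    · obtain ⟨a, b, h⟩ := Graph.exists_isLink_of_mem_edgeSet he
      exact ⟨_, _, Or.inl ⟨e₁, a, b, h, rfl, rfl, rfl⟩⟩
    · obtain ⟨a, b, h⟩ := Graph.exists_isLink_of_mem_edgeSet he
      exact ⟨_, _, Or.inr ⟨e₂, a, b, h, rfl, rfl, rfl⟩⟩

theorem loopless_gluing [G₁.Loopless] [G₂.Loopless] : (vertexGluing G₁ v₁ G₂ v₂).Loopless := by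
  refine ⟨fun e x h => ?_⟩
  rcases h with ⟨e₁, a, b, h, -, rfl, hb⟩ | ⟨e₂, a, b, h, -, rfl, hb⟩
  · exact h.ne (Sum.inl_injective hb)
  · exact h.ne (glueRight_injective _ _ hb)

theorem connected_gluing (h₁ : G₁.toSimpleGraph.Connected) (h₂ : G₂.toSimpleGraph.Connected) :
    (vertexGluing G₁ v₁ G₂ v₂).toSimpleGraph.Connected := by
  let φ₁ : G₁.toSimpleGraph →g (vertexGluing G₁ v₁ G₂ v₂).toSimpleGraph :=
    { toFun := gluingInl v₁ v₂
      map_rel' := fun {x y} h => ⟨(gluingInl_injective v₁ v₂).ne h.1, by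
        obtain ⟨e, he⟩ := h.2
        exact ⟨Sum.inl e, Or.inl ⟨e, x, y, he, rfl, rfl, rfl⟩⟩⟩ }
  let φ₂ : G₂.toSimpleGraph →g (vertexGluing G₁ v₁ G₂ v₂).toSimpleGraph :=
    { toFun := gluingInr v₁ v₂
      map_rel' := fun {x y} h => ⟨(gluingInr_injective v₁ v₂).ne h.1, by
        obtain ⟨e, he⟩ := h.2
        exact ⟨Sum.inr e, Or.inr ⟨e, x, y, he, rfl, rfl, rfl⟩⟩⟩ }
  refine (SimpleGraph.connected_iff_exists_forall_reachable _).2 ⟨gluingInl v₁ v₂ v₁, fun z => ?_⟩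
  rcases gluing_cases v₁ v₂ z with ⟨x, rfl⟩ | ⟨y, rfl⟩
  · exact (h₁.preconnected v₁ x).map φ₁
  · rw [gluingInl_self]
    exact (h₂.preconnected v₂ y).map φ₂

theorem IsFiniteConnectedLoopless.gluing (h₁ : IsFiniteConnectedLoopless G₁)
    (h₂ : IsFiniteConnectedLoopless G₂) :
    IsFiniteConnectedLoopless (vertexGluing G₁ v₁ G₂ v₂) where
  finite_vertexSet := (h₁.finite_vertexSet.image _).union (h₂.finite_vertexSet.image _)
  finite_edgeSet := by
    rw [edgeSet_gluing]
    exact (h₁.finite_edgeSet.image _).union (h₂.finite_edgeSet.image _)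
  loopless := by
    have := h₁.loopless
    have := h₂.loopless
    exact loopless_gluing v₁ v₂
  connected := connected_gluing v₁ v₂ h₁.connected h₂.connected

/-! ### Splitting divisors and chip-firing along the common vertex -/

/-- The pushforward to a vertex gluing of a pair of divisors on the two graphs. -/
def glueDivisor (D₁ : Divisor G₁) (D₂ : Divisor G₂) : Divisor (vertexGluing G₁ v₁ G₂ v₂) :=
  Function.extend (gluingInl v₁ v₂) D₁ 0 + Function.extend (gluingInr v₁ v₂) D₂ 0

theorem glueDivisor_inl (D₁ : Divisor G₁) (D₂ : Divisor G₂) {x : V(G₁)} (hx : x ≠ v₁) :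
    glueDivisor v₁ v₂ D₁ D₂ (gluingInl v₁ v₂ x) = D₁ x := by
  have h : ¬ ∃ y, gluingInr v₁ v₂ y = gluingInl v₁ v₂ x := fun ⟨_, hy⟩ =>
    hx ((gluingInl_eq_gluingInr_iff v₁ v₂).1 hy.symm).1
  simp [glueDivisor, (gluingInl_injective v₁ v₂).extend_apply, Function.extend_apply' _ _ _ h]

theorem glueDivisor_inr (D₁ : Divisor G₁) (D₂ : Divisor G₂) {y : V(G₂)} (hy : y ≠ v₂) :
    glueDivisor v₁ v₂ D₁ D₂ (gluingInr v₁ v₂ y) = D₂ y := by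
  have h : ¬ ∃ x, gluingInl v₁ v₂ x = gluingInr v₁ v₂ y := fun ⟨_, hx⟩ =>
    hy ((gluingInl_eq_gluingInr_iff v₁ v₂).1 hx).2
  simp [glueDivisor, (gluingInr_injective v₁ v₂).extend_apply, Function.extend_apply' _ _ _ h]

theorem glueDivisor_self (D₁ : Divisor G₁) (D₂ : Divisor G₂) :
    glueDivisor v₁ v₂ D₁ D₂ (gluingInl v₁ v₂ v₁) = D₁ v₁ + D₂ v₂ := by
  rw [glueDivisor, Pi.add_apply, (gluingInl_injective v₁ v₂).extend_apply, gluingInl_self,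
    (gluingInr_injective v₁ v₂).extend_apply]

theorem eq_glueDivisor {D₁ : Divisor G₁} {D₂ : Divisor G₂}
    {D : Divisor (vertexGluing G₁ v₁ G₂ v₂)} (h₁ : ∀ x ≠ v₁, D (gluingInl v₁ v₂ x) = D₁ x)
    (h₂ : ∀ y ≠ v₂, D (gluingInr v₁ v₂ y) = D₂ y) (h : D (gluingInl v₁ v₂ v₁) = D₁ v₁ + D₂ v₂) :
    D = glueDivisor v₁ v₂ D₁ D₂ := by
  funext z
  rcases gluing_cases v₁ v₂ z with ⟨x, rfl⟩ | ⟨y, rfl⟩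
  · by_cases hx : x = v₁
    · rw [hx, h, glueDivisor_self]
    · rw [h₁ x hx, glueDivisor_inl v₁ v₂ _ _ hx]
  · by_cases hy : y = v₂
    · rw [hy, ← gluingInl_self, h, glueDivisor_self]
    · rw [h₂ y hy, glueDivisor_inr v₁ v₂ _ _ hy]

theorem exists_eq_glueDivisor (D : Divisor (vertexGluing G₁ v₁ G₂ v₂)) :
    ∃ D₁ D₂, D = glueDivisor v₁ v₂ D₁ D₂ := by
  classical
  -- The chips at the common vertex are all assigned to the first side, an arbitrary choice.
  refine ⟨D ∘ gluingInl v₁ v₂, Function.update (D ∘ gluingInr v₁ v₂) v₂ 0,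
    eq_glueDivisor v₁ v₂ (fun _ _ => rfl) (fun y hy => ?_) ?_⟩
  · rw [Function.update_of_ne hy, Function.comp_apply]
  · rw [Function.update_self, add_zero, Function.comp_apply]

theorem glueDivisor_sub (D₁ E₁ : Divisor G₁) (D₂ E₂ : Divisor G₂) :
    glueDivisor v₁ v₂ D₁ D₂ - glueDivisor v₁ v₂ E₁ E₂ =
      glueDivisor v₁ v₂ (D₁ - E₁) (D₂ - E₂) := by
  refine eq_glueDivisor v₁ v₂ (fun x hx => ?_) (fun y hy => ?_) ?_
  · simp only [Pi.sub_apply, glueDivisor_inl v₁ v₂ _ _ hx]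
  · simp only [Pi.sub_apply, glueDivisor_inr v₁ v₂ _ _ hy]
  · simp only [Pi.sub_apply, glueDivisor_self]
    ring

theorem glueDivisor_nonneg {D₁ : Divisor G₁} {D₂ : Divisor G₂} (h₁ : 0 ≤ D₁) (h₂ : 0 ≤ D₂) :
    0 ≤ glueDivisor v₁ v₂ D₁ D₂ := by
  intro z
  rcases gluing_cases v₁ v₂ z with ⟨x, rfl⟩ | ⟨y, rfl⟩
  · by_cases hx : x = v₁
    · rw [hx, glueDivisor_self]
      exact add_nonneg (h₁ v₁) (h₂ v₂)
    · rw [glueDivisor_inl v₁ v₂ _ _ hx]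
      exact h₁ x
  · by_cases hy : y = v₂
    · rw [hy, ← gluingInl_self, glueDivisor_self]
      exact add_nonneg (h₁ v₁) (h₂ v₂)
    · rw [glueDivisor_inr v₁ v₂ _ _ hy]
      exact h₂ y

variable [Finite V(G₁)] [Finite V(G₂)] (f : V(vertexGluing G₁ v₁ G₂ v₂) → ℤ)

/-- Among the vertices of the second side, `x` can be adjacent only to the common one, and that term
cancels the inclusion–exclusion correction. -/
theorem principal_gluing_inl [G₂.Loopless] {x : V(G₁)} (hx : x ≠ v₁) :
    principal f (gluingInl v₁ v₂ x) = principal (f ∘ gluingInl v₁ v₂) x := by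
  unfold principal
  rw [finsum_gluing, finsum_eq_single (fun y : V(G₂) => _) v₂]
  · rw [← gluingInl_self, add_sub_cancel_right]
    simp only [ncard_isLink_gluing_inl_inl, Function.comp_apply]
  · intro y hy
    simp [ncard_isLink_gluing_inl_inr v₁ v₂ hx hy]

theorem principal_gluing_inr [G₁.Loopless] {y : V(G₂)} (hy : y ≠ v₂) :
    principal f (gluingInr v₁ v₂ y) = principal (f ∘ gluingInr v₁ v₂) y := by
  unfold principal
  rw [finsum_gluing, finsum_eq_single (fun x : V(G₁) => _) v₁]
  · rw [add_sub_cancel_left]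
    simp only [ncard_isLink_gluing_inr_inr, Function.comp_apply]
  · intro x hx
    simp only [Graph.isLink_comm (x := (gluingInr v₁ v₂ y).1)]
    simp [ncard_isLink_gluing_inl_inr v₁ v₂ hx hy]

theorem principal_gluing_self [G₁.Loopless] [G₂.Loopless] :
    principal f (gluingInl v₁ v₂ v₁) =
      principal (f ∘ gluingInl v₁ v₂) v₁ + principal (f ∘ gluingInr v₁ v₂) v₂ := by
  unfold principal
  rw [finsum_gluing]
  simp only [ncard_isLink_gluing_inl_inl, Function.comp_apply, sub_self, mul_zero, sub_zero]
  congr 1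
  simp only [gluingInl_self, ncard_isLink_gluing_inr_inr]

theorem degree_glueDivisor (D₁ : Divisor G₁) (D₂ : Divisor G₂) :
    degree (glueDivisor v₁ v₂ D₁ D₂) = degree D₁ + degree D₂ := by
  have := finite_gluing v₁ v₂
  rw [glueDivisor, degree_add]
  exact congrArg₂ (· + ·) (finsum_extend_zero (gluingInl_injective v₁ v₂) D₁)
    (finsum_extend_zero (gluingInr_injective v₁ v₂) D₂)

/-- On a vertex gluing, chips can only be exchanged between the two sides at the common vertex. -/
theorem exists_isEquivEffective_of_glueDivisor [G₁.Loopless] [G₂.Loopless] {D₁ : Divisor G₁}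
    {D₂ : Divisor G₂} (h : IsEquivEffective (glueDivisor v₁ v₂ D₁ D₂)) :
    ∃ l m : ℤ, l + m ≤ 0 ∧ IsEquivEffective (D₁ + l • ofVertex v₁) ∧
      IsEquivEffective (D₂ + m • ofVertex v₂) := by
  obtain ⟨f, hf⟩ := h
  -- After firing the restricted scripts, `l` and `m` reset the coefficients at `v₁` and `v₂` to
  -- zero. Their sum is minus the nonnegative coefficient at the common vertex.
  refine ⟨-(D₁ + principal (f ∘ gluingInl v₁ v₂)) v₁, -(D₂ + principal (f ∘ gluingInr v₁ v₂)) v₂,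
    ?_, ⟨f ∘ gluingInl v₁ v₂, ?_⟩, ⟨f ∘ gluingInr v₁ v₂, ?_⟩⟩
  · have := hf (gluingInl v₁ v₂ v₁)
    simp only [Pi.zero_apply, Pi.add_apply, principal_gluing_self, glueDivisor_self] at this ⊢
    lia
  · rw [add_right_comm]
    refine nonneg_add_zsmul_ofVertex fun x hx => ?_
    simpa only [Pi.zero_apply, Pi.add_apply, principal_gluing_inl v₁ v₂ f hx,
      glueDivisor_inl v₁ v₂ _ _ hx] using hf (gluingInl v₁ v₂ x)
  · rw [add_right_comm]
    refine nonneg_add_zsmul_ofVertex fun y hy => ?_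
    simpa only [Pi.zero_apply, Pi.add_apply, principal_gluing_inr v₁ v₂ f hy,
      glueDivisor_inr v₁ v₂ _ _ hy] using hf (gluingInr v₁ v₂ y)

theorem poleOrder_add_poleOrder_le [G₁.Loopless] [G₂.Loopless] {D₁ : Divisor G₁}
    {D₂ : Divisor G₂} {i j : ℕ} (h : ((i + j : ℕ) : ℤ) ≤ rank (glueDivisor v₁ v₂ D₁ D₂)) :
    poleOrder D₁ v₁ i + poleOrder D₂ v₂ j ≤ 0 := by
  have := finite_gluing v₁ v₂
  obtain ⟨E₁, hE₁, hd₁, hl⟩ := exists_forall_poleOrder_le D₁ v₁ i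
  obtain ⟨E₂, hE₂, hd₂, hm⟩ := exists_forall_poleOrder_le D₂ v₂ j
  have key := (le_rank_iff (gluingInl v₁ v₂ v₁) (Int.natCast_nonneg _)).1 h
    (glueDivisor v₁ v₂ E₁ E₂) (glueDivisor_nonneg v₁ v₂ hE₁ hE₂)
    (by rw [degree_glueDivisor, hd₁, hd₂, Nat.cast_add])
  rw [glueDivisor_sub] at key
  obtain ⟨l, m, hlm, h₁, h₂⟩ := exists_isEquivEffective_of_glueDivisor v₁ v₂ key
  rw [sub_add_eq_add_sub] at h₁ h₂
  exact (add_le_add (hl l h₁) (hm m h₂)).trans hlm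

theorem le_genus_add_genus [G₁.Loopless] [G₂.Loopless] (h₁ : IsMarkedBrillNoetherGeneral G₁ v₁)
    (h₂ : IsMarkedBrillNoetherGeneral G₂ v₂) {D : Divisor (vertexGluing G₁ v₁ G₂ v₂)} {r : ℕ}
    (hr : (r : ℤ) ≤ rank D) :
    (r + 1) * (genus G₁ + genus G₂ - degree D + r) ≤ genus G₁ + genus G₂ := by
  obtain ⟨D₁, D₂, rfl⟩ := exists_eq_glueDivisor v₁ v₂ D
  rw [degree_glueDivisor]
  refine le_trans ?_ (add_le_add (sum_weierstrassPart_le h₁ D₁ (Finset.range (r + 1)))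
    (sum_weierstrassPart_le h₂ D₂ (Finset.range (r + 1))))
  -- Reversing the second sum pairs index `i` with `r - i`; each pair contributes at least the same
  -- constant.
  rw [← Finset.sum_flip (weierstrassPart D₂ v₂), ← Finset.sum_add_distrib]
  calc _ = (Finset.range (r + 1)).card •
        (genus G₁ + genus G₂ - (degree D₁ + degree D₂) + r) := by simp
    _ ≤ _ := Finset.card_nsmul_le_sum _ _ _ fun i hi => ?_
  have hi' : i + (r - i) = r := by
    have := Finset.mem_range.1 hi
    lia
  have := poleOrder_add_poleOrder_le v₁ v₂ (i := i) (j := r - i) (hi'.symm ▸ hr)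
  unfold weierstrassPart
  lia

/-! ### Genus of the gluing -/

theorem ncard_vertexSet_gluing :
    V(vertexGluing G₁ v₁ G₂ v₂).ncard + 1 = V(G₁).ncard + V(G₂).ncard := by
  have h := Set.ncard_union_add_ncard_inter (Set.range (gluingInl v₁ v₂))
    (Set.range (gluingInr v₁ v₂)) (Set.finite_range _) (Set.finite_range _)
  rw [range_gluingInl_union_range_gluingInr, range_gluingInl_inter_range_gluingInr,
    Set.ncard_singleton, Set.ncard_univ, ← Set.image_univ, ← Set.image_univ,
    Set.ncard_image_of_injective _ (gluingInl_injective v₁ v₂),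
    Set.ncard_image_of_injective _ (gluingInr_injective v₁ v₂), Set.ncard_univ,
    Set.ncard_univ] at h
  simpa only [Nat.card_coe_set_eq] using h

theorem genus_gluing (hE₁ : E(G₁).Finite) (hE₂ : E(G₂).Finite) :
    genus (vertexGluing G₁ v₁ G₂ v₂) = genus G₁ + genus G₂ := by
  have hV := ncard_vertexSet_gluing v₁ v₂
  have hE : E(vertexGluing G₁ v₁ G₂ v₂).ncard = E(G₁).ncard + E(G₂).ncard := by
    rw [edgeSet_gluing, Set.ncard_union_eq Set.disjoint_image_inl_image_inr (hE₁.image _)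
      (hE₂.image _), Set.ncard_image_of_injective _ Sum.inl_injective,
      Set.ncard_image_of_injective _ Sum.inr_injective]
  unfold genus
  lia

end Gluing

end BrillNoether

end

theorem mainTheorem11 {α₁ β₁ α₂ β₂ : Type*}
    (G₁ : Graph α₁ β₁) (G₂ : Graph α₂ β₂)
    (hG₁ : BrillNoether.IsFiniteConnectedLoopless G₁)
    (hG₂ : BrillNoether.IsFiniteConnectedLoopless G₂)
    (v₁ : Graph.vertexSet G₁) (v₂ : Graph.vertexSet G₂)
    (h₁ : BrillNoether.IsMarkedBrillNoetherGeneral G₁ v₁)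
    (h₂ : BrillNoether.IsMarkedBrillNoetherGeneral G₂ v₂) :
    BrillNoether.IsFiniteConnectedLoopless (BrillNoether.vertexGluing G₁ v₁ G₂ v₂) ∧
      BrillNoether.genus (BrillNoether.vertexGluing G₁ v₁ G₂ v₂) =
        BrillNoether.genus G₁ + BrillNoether.genus G₂ ∧
      BrillNoether.IsBrillNoetherGeneral (BrillNoether.vertexGluing G₁ v₁ G₂ v₂) := by
  have := hG₁.finite_vertexSet.to_subtype
  have := hG₂.finite_vertexSet.to_subtype
  have := hG₁.loopless
  have := hG₂.loopless
  have hg := BrillNoether.genus_gluing v₁ v₂ hG₁.finite_edgeSet hG₂.finite_edgeSet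
  refine ⟨hG₁.gluing v₁ v₂ hG₂, hg, ?_⟩
  rintro d r ⟨hr, D, hd, hD⟩
  dsimp only at hr hd hD
  unfold BrillNoether.brillNoetherNumber
  rw [hg, ← hd]
  rcases eq_or_lt_of_le hr with rfl | hr
  -- For `r = -1` the claim is `0 ≤ g₁ + g₂`; empty partial sums show that both genera are
  -- nonnegative.
  · have hg₁ := BrillNoether.sum_weierstrassPart_le h₁ 0 ∅
    have hg₂ := BrillNoether.sum_weierstrassPart_le h₂ 0 ∅
    rw [Finset.sum_empty] at hg₁ hg₂
    lia
  · lift r to ℕ using by lia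
    exact sub_nonneg.2 (BrillNoether.le_genus_add_genus v₁ v₂ h₁ h₂ hD)
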